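/- \textbf{Definitions.} An \emph{arithmetical graph} $(G,R)$ consists of a finite connected loopless multigraph $G$ on vertices $v_0,\dots,v_n$ with adjacency matrix $A$, and a vector $R=(r(v_0),\dots,r(v_n))$ of positive integers (the multiplicities) with greatest common divisor $1$, such that $(\mathcal D-A)R=0$ for a diagonal matrix $\mathcal D=\mathrm{diag}(\delta(v_0),\dots,\delta(v_n))$ of natural numbers. Let $\Lambda=\Lambda_{(G,R)}\subseteq\mathbb Z^{n+1}$ be the lattice spanned by the columns of $Q=\mathcal D-A$. It is a lattice of rank $n$ in $\{D\in\mathbb Z^{n+1}: R\cdot D=0\}$. For $D\in\mathbb Z^{n+1}$ (a divisor) put $\deg_R(D)=R\cdot D$ and $|D|=\{E\in\mathbb Z^{n+1}: E\ge 0,\ E-D\in\Lambda\}$, and define the rank $$r(D)=\min\{\deg_R(E): E\ge 0,\ |D-E|=\emptyset\}-1 .$$ Let $\Sigma(\Lambda)=\{D\in\mathbb Z^{n+1}: D\not\ge p\text{ for all }p\in\Lambda\}$, and call $\nu\in\Sigma(\Lambda)$ \emph{extreme} if $\deg_R(\nu)\ge\deg_R(p)$ for all $p\in\Sigma(\Lambda)$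 with $\sum_i|p_i-\nu_i|\le 1$. Let $g_{\min}$ and $g_{\max}$ be the minimum and the maximum of $\deg_R(\nu)+1$ over all extreme $\nu$. The arithmetical graph $(G,R)$ has the \emph{Riemann--Roch property} if $g_{\min}=g_{\max}=:g$ and there is a divisor $K$ with $\deg_R(K)=2g-2$ such that for all $D\in\mathbb Z^{n+1}$ $$r(D)-r(K-D)=\deg_R(D)-g+1 .$$ For positive integers $r_0>r_1$, the \emph{Euclidean sequence} generated by $r_0$ and $r_1$ is the strictly decreasing sequence of positive integers $r_0,r_1,\dots,r_m$ ($m\ge 1$) with $r_{i+1}=\delta_i r_i-r_{i-1}$, $\delta_i\in\mathbb N$, for $1\le i<m$, that is continued until the next term would be $0$, i.e. $r_m\mid r_{m-1}$. A \emph{Euclidean chain} leaving a vertex $v_0$ generated by $r_0$ and $r_1$ is an induced path $v_0,v_1,\dots,v_m$ in $G$ such that $v_m$ has degree $1$ in $G$ and the multiplicities of $v_0,\dots,v_m$ are the Euclidean sequence $r_0,\dots,r_m$ generated by $r_0$ and $r_1$. A \emph{Euclidean star} generated by $r_0$ and $r_1$ is an arithmetical graph that is the union of $r_0$ Euclidean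 chains generated by $r_0$ and $r_1$, all leaving one vertex $v_0$ (the center, of multiplicity $r_0$), where distinct chains share only the vertex $v_0$ and there are no further edges between them. (Since the multiplicities of an arithmetical graph have no common factor, necessarily $\gcd(r_0,r_1)=1$.) \textbf{Theorem.} Every Euclidean star has the Riemann--Roch property. -/

import Mathlib

/-! ### Riemann–Roch theory for lattices orthogonal to a weight vector

Throughout, `V` is the finite index set of the coordinates, a divisor is a vector `D : V → ℤ`, and
`R : V → ℕ` is the (positive) weight vector. -/

section Lattice

variable {V : Type*} [Fintype V]

/-- The weighted degree `R · D`. -/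
def wdeg (R : V → ℕ) (D : V → ℤ) : ℤ := ∑ v, (R v : ℤ) * D v

/-- The linear system `|D|`: all effective divisors equivalent to `D` modulo `L`. -/
def linearSystem (L : Submodule ℤ (V → ℤ)) (D : V → ℤ) : Set (V → ℤ) :=
  {E | 0 ≤ E ∧ E - D ∈ L}

/-- The rank `r(D) = min {deg_R E : E ≥ 0, |D - E| = ∅} - 1`. -/
noncomputable def divisorRank (R : V → ℕ) (L : Submodule ℤ (V → ℤ)) (D : V → ℤ) : ℤ :=
  sInf {d : ℤ | ∃ E : V → ℤ, 0 ≤ E ∧ linearSystem L (D - E) = ∅ ∧ wdeg R E = d} - 1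

/-- The region `Σ(L)` of integer points that dominate no lattice point. -/
def sigmaRegion (L : Submodule ℤ (V → ℤ)) : Set (V → ℤ) :=
  {D | ∀ p ∈ L, ¬ p ≤ D}

/-- The extreme divisors: the points of `Σ(L)` whose degree is largest among the points of `Σ(L)`
at `ℓ¹`-distance at most one. -/
def extremeDivisors (R : V → ℕ) (L : Submodule ℤ (V → ℤ)) : Set (V → ℤ) :=
  {ν | ν ∈ sigmaRegion L ∧
    ∀ p ∈ sigmaRegion L, ∑ v, |p v - ν v| ≤ 1 → wdeg R p ≤ wdeg R ν}

/-- The numbers `deg_R ν + 1` over all extreme divisors `ν`; the least and the greatest of them are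
`g_min` and `g_max`. -/
def extremeGenera (R : V → ℕ) (L : Submodule ℤ (V → ℤ)) : Set ℤ :=
  {g | ∃ ν ∈ extremeDivisors R L, wdeg R ν + 1 = g}

/-- `L` is a lattice of rank `|V| - 1` in the orthogonal complement of `R`. -/
def IsFullDimensional (R : V → ℕ) (L : Submodule ℤ (V → ℤ)) : Prop :=
  (∀ p ∈ L, wdeg R p = 0) ∧ Module.finrank ℤ L + 1 = Fintype.card V

/-- The Riemann–Roch property of a lattice: it is a full-dimensional sublattice of the orthogonal
complement of `R`, it is uniform (`g_min = g_max = g`), and there is a divisor `K` of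
degree `2g - 2` with `r(D) - r(K - D) = deg_R D - g + 1` for every divisor `D`. -/
def HasRiemannRochProperty (R : V → ℕ) (L : Submodule ℤ (V → ℤ)) : Prop :=
  IsFullDimensional R L ∧
  ∃ g : ℤ, IsLeast (extremeGenera R L) g ∧ IsGreatest (extremeGenera R L) g ∧
    ∃ K : V → ℤ, wdeg R K = 2 * g - 2 ∧
      ∀ D : V → ℤ, divisorRank R L D - divisorRank R L (K - D) = wdeg R D - g + 1

end Lattice

/-! ### Arithmetical graphs -/

/-- An arithmetical graph on the vertex set `V`: a connected loopless multigraph, given by its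
adjacency matrix (numbers of edges), and a vector of positive multiplicities without common factor
such that `(diag(δ) - A) R = 0`. -/
structure ArithmeticalGraph (V : Type*) [Fintype V] where
  /-- the number of edges between two vertices -/
  edges : Matrix V V ℕ
  edges_symm : ∀ v w, edges v w = edges w v
  edges_self : ∀ v, edges v v = 0
  connected : (SimpleGraph.fromRel fun v w => 0 < edges v w).Connected
  /-- the multiplicity of a vertex -/
  mult : V → ℕ
  mult_pos : ∀ v, 0 < mult v
  mult_gcd : Finset.univ.gcd mult = 1
  /-- the diagonal entries of the Laplacian -/
  delta : V → ℕ
  balanced : ∀ v, delta v * mult v = ∑ w, edges v w * mult w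

namespace ArithmeticalGraph

variable {V : Type*} [Fintype V]

/-- The degree of a vertex: the number of edges at it. -/
def degree (X : ArithmeticalGraph V) (v : V) : ℕ := ∑ w, X.edges v w

/-- The Laplacian `diag(δ) - A`. -/
def laplacian [DecidableEq V] (X : ArithmeticalGraph V) : Matrix V V ℤ :=
  Matrix.diagonal (fun v => (X.delta v : ℤ)) - X.edges.map (fun n => (n : ℤ))

/-- The lattice spanned by the columns of the Laplacian. -/
def lattice [DecidableEq V] (X : ArithmeticalGraph V) : Submodule ℤ (V → ℤ) :=
  Submodule.span ℤ (Set.range X.laplacian.col)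

/-- An arithmetical graph has the Riemann–Roch property if its lattice has it with respect to the
vector of multiplicities. -/
def RiemannRochProperty [DecidableEq V] (X : ArithmeticalGraph V) : Prop :=
  HasRiemannRochProperty X.mult X.lattice

end ArithmeticalGraph

/-! ### Euclidean stars -/

/-- `r` lists the Euclidean sequence `r₀ > r₁ > ⋯` generated by `a` and `b`: it starts with `a`, `b`,
it is a strictly decreasing sequence of positive integers, each further term is
`r_{i+1} = δ_i r_i - r_{i-1}` for a natural number `δ_i`, and the sequence goes on until the next
term would be `0`, i.e. the last term divides the one before it. -/
structure IsEuclideanSequence (a b : ℕ) {m : ℕ} (r : Fin (m + 2) → ℕ) : Prop where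
  zero : r 0 = a
  one : r 1 = b
  pos : ∀ i, 0 < r i
  decreasing : StrictAnti r
  step : ∀ i : Fin m, ∃ d : ℕ, (r i.succ.succ : ℤ) = d * r i.succ.castSucc - r i.castSucc.castSucc
  terminal : r (Fin.last (m + 1)) ∣ r (Fin.last m).castSucc

/-- `C` lists the vertices of a Euclidean chain leaving `v₀` generated by `a` and `b`: an induced
path starting at `v₀` and ending at a vertex of degree one, whose multiplicities form the Euclidean
sequence generated by `a` and `b`. -/
structure IsEuclideanChain {V : Type*} [Fintype V] (X : ArithmeticalGraph V) (v₀ : V) (a b : ℕ)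
    {m : ℕ} (C : Fin (m + 2) → V) : Prop where
  start : C 0 = v₀
  injective : Function.Injective C
  induced : ∀ i j : Fin (m + 2), X.edges (C i) (C j) =
    if (i : ℕ) + 1 = j ∨ (j : ℕ) + 1 = i then 1 else 0
  leaf : X.degree (C (Fin.last (m + 1))) = 1
  euclidean : IsEuclideanSequence a b (fun i => X.mult (C i))

/-- `X` is a Euclidean star with center `v₀` generated by `r₀` and `r₁`: it is the union of `r₀`
Euclidean chains leaving `v₀` generated by `r₀` and `r₁`, any two of which share only the vertex
`v₀` and are joined by no further edge. -/
def IsEuclideanStar {V : Type*} [Fintype V] (X : ArithmeticalGraph V) (v₀ : V) (r₀ r₁ : ℕ) : Prop :=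
  ∃ (m : ℕ) (C : Fin r₀ → Fin (m + 2) → V),
    (∀ k, IsEuclideanChain X v₀ r₀ r₁ (C k)) ∧
    (∀ v, ∃ k i, C k i = v) ∧
    (∀ k l i j, k ≠ l → C k i = C l j → C k i = v₀) ∧
    (∀ k l i j, k ≠ l → C k i ≠ v₀ → C l j ≠ v₀ → X.edges (C k i) (C l j) = 0)

/-! ### Extreme divisors, ranks and reflection -/

section Lattice

variable {V : Type*} {L : Submodule ℤ (V → ℤ)}

/-! Write `n` for the center's multiplicity and `b k D` for the weighted degree of `D` on the `k`-th
chain without its center. The lattice consists of the degree-zero divisors whose chain degrees are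
all congruent modulo `n` (`mem_lattice_iff`). Hence whether `D` dominates a lattice point depends
only on its degree and the residues of the `b k D` up to a common shift (`notMem_sigmaRegion_iff`).
It follows that `ν` is extreme exactly when the `b k ν` represent every class modulo `n` and the
degree is `n(n-3)/2` (`IsStarLattice.mem_extremeDivisors_iff`).

So all extreme divisors have the same degree, and `ν ↦ K - ν` preserves them for `K = (n-3)v₀`,
since `K` has no chain degree and negation keeps residues distinct. Uniformity and this symmetry
give Riemann–Roch, because `r(D) + 1` is the minimum over extreme `ν` of the degree of the positive
part of `D - ν`. -/

theorem sigmaRegion_anti {D E : V → ℤ} (hE : E ∈ sigmaRegion L) (h : D ≤ E) :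
    D ∈ sigmaRegion L :=
  fun p hp hpD => hE p hp (hpD.trans h)

theorem linearSystem_eq_empty_iff {D : V → ℤ} : linearSystem L D = ∅ ↔ D ∈ sigmaRegion L := by
  rw [Set.eq_empty_iff_forall_notMem]
  constructor
  · intro h p hp hpD
    exact h (D - p) ⟨sub_nonneg.2 hpD, by simpa using hp⟩
  · rintro h E ⟨hE, hL⟩
    exact h (D - E) (by simpa using L.neg_mem hL) (by simpa using hE)

variable [Fintype V] {R : V → ℕ}

theorem wdeg_add (R : V → ℕ) (D E : V → ℤ) : wdeg R (D + E) = wdeg R D + wdeg R E := by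
  simp [wdeg, mul_add, Finset.sum_add_distrib]

theorem wdeg_sub (R : V → ℕ) (D E : V → ℤ) : wdeg R (D - E) = wdeg R D - wdeg R E := by
  simp [wdeg, mul_sub, Finset.sum_sub_distrib]

theorem wdeg_smul (R : V → ℕ) (c : ℤ) (D : V → ℤ) : wdeg R (c • D) = c * wdeg R D := by
  simp only [wdeg, Pi.smul_apply, smul_eq_mul, Finset.mul_sum]
  exact Finset.sum_congr rfl fun v _ => by ring

theorem wdeg_single [DecidableEq V] (R : V → ℕ) (v : V) (c : ℤ) :
    wdeg R (Pi.single v c) = R v * c := by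
  simp [wdeg, Pi.single_apply]

theorem wdeg_mono (R : V → ℕ) {D E : V → ℤ} (h : D ≤ E) : wdeg R D ≤ wdeg R E :=
  Finset.sum_le_sum fun v _ => mul_le_mul_of_nonneg_left (h v) (Int.natCast_nonneg _)

/-- The weighted degree as a linear map. -/
def wdegLinear (R : V → ℕ) : (V → ℤ) →ₗ[ℤ] ℤ where
  toFun := wdeg R
  map_add' := wdeg_add R
  map_smul' := wdeg_smul R

/-- If `p` exceeds `ν` at `v`, the distance budget of one is used up there, so `p ≤ ν + e_v`, and
the region is closed downwards. -/
theorem mem_extremeDivisors_iff [DecidableEq V] (hR : ∀ v, 0 < R v) {ν : V → ℤ} :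
    ν ∈ extremeDivisors R L ↔
      ν ∈ sigmaRegion L ∧ ∀ v, ν + Pi.single v 1 ∉ sigmaRegion L := by
  refine and_congr_right fun hν => ⟨fun h v hv => ?_, fun h p hp hpν => ?_⟩
  · have h1 := h _ hv (by simp [Pi.single_apply, apply_ite abs])
    rw [wdeg_add, wdeg_single] at h1
    have := hR v
    lia
  · by_cases hle : p ≤ ν
    · exact wdeg_mono R hle
    · exfalso
      obtain ⟨v, hv⟩ : ∃ v, ν v < p v := by simpa [Pi.le_def] using hle
      refine h v (sigmaRegion_anti hp fun w => ?_)
      rcases eq_or_ne w v with rfl | hw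
      · simpa using hv
      · have h2 : ∑ u ∈ {v, w}, |p u - ν u| ≤ 1 :=
          (Finset.sum_le_sum_of_subset_of_nonneg (Finset.subset_univ _)
            fun _ _ _ => abs_nonneg _).trans hpν
        rw [Finset.sum_pair hw.symm] at h2
        have h3 := le_abs_self (p v - ν v)
        have h4 := neg_le_abs (p w - ν w)
        simp only [Pi.add_apply, Pi.single_eq_of_ne hw]
        lia

theorem exists_extremeDivisor_ge [DecidableEq V] (hR : ∀ v, 0 < R v) {B : ℤ}
    (hB : ∀ D ∈ sigmaRegion L, wdeg R D ≤ B) {D : V → ℤ} (hD : D ∈ sigmaRegion L) :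
    ∃ ν ∈ extremeDivisors R L, D ≤ ν := by
  induction h : (B - wdeg R D).toNat using Nat.strong_induction_on generalizing D with
  | _ t ih =>
    by_cases hmax : ∀ v, D + Pi.single v 1 ∉ sigmaRegion L
    · exact ⟨D, (mem_extremeDivisors_iff hR).2 ⟨hD, hmax⟩, le_rfl⟩
    · push Not at hmax
      obtain ⟨v, hv⟩ := hmax
      have hdeg : wdeg R (D + Pi.single v 1) = wdeg R D + R v := by
        rw [wdeg_add, wdeg_single, mul_one]
      obtain ⟨ν, hν, hle⟩ := ih _ (by have := hB _ hv; have := hR v; lia) hv rfl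
      exact ⟨ν, hν, le_trans (le_add_of_nonneg_right (Pi.single_nonneg.2 zero_le_one)) hle⟩

theorem divisorRank_le {ν : V → ℤ} (hν : ν ∈ sigmaRegion L) (D : V → ℤ) :
    divisorRank R L D ≤ wdeg R ((D - ν) ⊔ 0) - 1 := by
  have hempty : linearSystem L (D - (D - ν) ⊔ 0) = ∅ :=
    linearSystem_eq_empty_iff.2 (sigmaRegion_anti hν (sub_le_comm.1 le_sup_left))
  refine sub_le_sub_right (csInf_le ?_ ?_) 1
  · refine ⟨0, ?_⟩
    rintro _ ⟨E, hE, -, rfl⟩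
    simpa [wdeg] using wdeg_mono R hE
  · exact ⟨_, le_sup_right, hempty, rfl⟩

/-- For a minimizing `E`, the divisor `D - E` lies below some extreme `ν`, which forces `E` to
dominate the positive part of `D - ν`. -/
theorem exists_le_divisorRank (hne : (extremeDivisors R L).Nonempty)
    (habove : ∀ D ∈ sigmaRegion L, ∃ ν ∈ extremeDivisors R L, D ≤ ν) (D : V → ℤ) :
    ∃ ν ∈ extremeDivisors R L, wdeg R ((D - ν) ⊔ 0) - 1 ≤ divisorRank R L D := by
  obtain ⟨E, hE, hempty, hdeg⟩ : sInf {d : ℤ | ∃ E : V → ℤ, 0 ≤ E ∧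
      linearSystem L (D - E) = ∅ ∧ wdeg R E = d} ∈ {d : ℤ | ∃ E : V → ℤ, 0 ≤ E ∧
      linearSystem L (D - E) = ∅ ∧ wdeg R E = d} := by
    refine Int.csInf_mem ?_ ⟨0, ?_⟩
    · obtain ⟨ν, hν, -⟩ := hne
      refine ⟨_, (D - ν) ⊔ 0, le_sup_right, linearSystem_eq_empty_iff.2
        (sigmaRegion_anti hν ?_), rfl⟩
      rw [sub_le_comm]
      exact le_sup_left
    · rintro _ ⟨E, hE, -, rfl⟩
      simpa [wdeg] using wdeg_mono R hE
  obtain ⟨ν, hν, hle⟩ := habove _ (linearSystem_eq_empty_iff.1 hempty)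
  refine ⟨ν, hν, sub_le_sub_right (hdeg ▸ wdeg_mono R (sup_le ?_ hE)) 1⟩
  rwa [sub_le_comm]

theorem wdeg_posPart_sub (R : V → ℕ) (D E : V → ℤ) :
    wdeg R ((D - E) ⊔ 0) - wdeg R ((E - D) ⊔ 0) = wdeg R D - wdeg R E := by
  rw [← wdeg_sub, ← wdeg_sub]
  congr 1
  ext v
  simp only [Pi.sub_apply, Pi.sup_apply, Pi.zero_apply]
  lia

/-- A uniform and reflection invariant lattice has the Riemann–Roch property. -/
theorem hasRiemannRochProperty_of_uniform_of_reflection (hfull : IsFullDimensional R L)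
    (hne : (extremeDivisors R L).Nonempty)
    (habove : ∀ D ∈ sigmaRegion L, ∃ ν ∈ extremeDivisors R L, D ≤ ν)
    {g : ℤ} (hunif : ∀ ν ∈ extremeDivisors R L, wdeg R ν + 1 = g)
    {K : V → ℤ} (hK : ∀ ν ∈ extremeDivisors R L, K - ν ∈ extremeDivisors R L) :
    HasRiemannRochProperty R L := by
  have hgen : extremeGenera R L = {g} := by
    ext x
    constructor
    · rintro ⟨ν, hν, rfl⟩
      exact hunif ν hν
    · rintro rfl
      exact ⟨_, hne.some_mem, hunif _ hne.some_mem⟩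
  refine ⟨hfull, g, by simp [hgen], by simp [hgen], K, ?_, fun D => ?_⟩
  · obtain ⟨ν, hν⟩ := hne
    have h1 := hunif _ hν
    have h2 := hunif _ (hK ν hν)
    rw [wdeg_sub] at h2
    lia
  -- Take `ν` optimal for `D` and `μ` optimal for `K - D`. Their reflections compete for the other
  -- rank, which bounds the difference of ranks from both sides.
  · obtain ⟨ν, hν, h1⟩ := exists_le_divisorRank hne habove D
    obtain ⟨μ, hμ, h2⟩ := exists_le_divisorRank hne habove (K - D)
    have h3 := divisorRank_le (R := R) (hK ν hν).1 (K - D)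
    have h4 := divisorRank_le (R := R) (hK μ hμ).1 D
    have h5 := wdeg_posPart_sub R D ν
    have h6 := wdeg_posPart_sub R D (K - μ)
    have h7 := hunif _ hν
    have h8 := hunif _ (hK μ hμ)
    rw [sub_sub_sub_cancel_left] at h3
    rw [sub_right_comm] at h2
    lia

end Lattice

/-! ### Sums of residues modulo `n` -/

section Residues

theorem Int.emod_natCast_le_self {a : ℤ} (ha : 0 ≤ a) (n : ℕ) : a % n ≤ a := by
  have h1 := Int.emod_add_mul_ediv a n
  have h2 := mul_nonneg (Int.natCast_nonneg n) (Int.ediv_nonneg ha (Int.natCast_nonneg n))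
  linarith

/-- The sum of the least nonnegative residues modulo `n` of the translates `x k + s`. -/
def residueSum (n : ℕ) (x : Fin n → ℤ) (s : ℤ) : ℤ := ∑ k, (x k + s) % n

variable {n : ℕ}

theorem dvd_sum_sub_residueSum (x : Fin n → ℤ) (s : ℤ) :
    (n : ℤ) ∣ ∑ k, x k - residueSum n x s := by
  have h : ∑ k, x k - residueSum n x s = ∑ k, ((x k + s) - (x k + s) % n) - n * s := by
    simp only [Finset.sum_sub_distrib, Finset.sum_add_distrib, Finset.sum_const, Finset.card_univ,
      Fintype.card_fin, nsmul_eq_mul, residueSum]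
    ring
  rw [h]
  exact dvd_sub (Finset.dvd_sum fun k _ => Int.dvd_self_sub_emod) (dvd_mul_right _ _)

theorem residueSum_update (x : Fin n → ℤ) (k : Fin n) (c s : ℤ) :
    residueSum n (fun l => x l + if l = k then c else 0) s =
      residueSum n x s + ((x k + c + s) % n - (x k + s) % n) := by
  rw [← sub_eq_iff_eq_add', residueSum, residueSum, ← Finset.sum_sub_distrib,
    Finset.sum_eq_single k (fun l _ hl => by simp [hl]) (by simp)]
  simp

theorem Int.add_one_emod_natCast (hn : 0 < n) (y : ℤ) :
    (y + 1) % n = y % n + 1 - if y % n = n - 1 then (n : ℤ) else 0 := by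
  have h0 := Int.emod_nonneg y (by lia : (n : ℤ) ≠ 0)
  have h1 := Int.emod_lt_of_pos y (by lia : (0 : ℤ) < n)
  rw [← Int.emod_add_emod]
  split_ifs with h
  · simp [h]
  · rw [Int.emod_eq_of_lt] <;> lia

theorem residueSum_add_one (hn : 0 < n) (x : Fin n → ℤ) (s : ℤ) :
    residueSum n x (s + 1) =
      residueSum n x s + n - ∑ k, if (x k + s) % n = n - 1 then (n : ℤ) else 0 := by
  simp only [residueSum, ← add_assoc, Int.add_one_emod_natCast hn, Finset.sum_sub_distrib,
    Finset.sum_add_distrib]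
  simp

theorem bijective_residue (hn : 0 < n) {x : Fin n → ℤ}
    (hx : ∀ k l, (n : ℤ) ∣ x k - x l → k = l) (s : ℤ) :
    ∃ σ : Equiv.Perm (Fin n), ∀ k, (x k + s) % n = (σ k : ℕ) := by
  have h0 k := Int.emod_nonneg (x k + s) (by lia : (n : ℤ) ≠ 0)
  have h1 k := Int.emod_lt_of_pos (x k + s) (by lia : (0 : ℤ) < n)
  let f : Fin n → Fin n := fun k => ⟨((x k + s) % n).toNat, by have := h0 k; have := h1 k; lia⟩
  have hf : Function.Injective f := by
    intro k l hkl
    have h2 : ((x k + s) % n).toNat = ((x l + s) % n).toNat := congrArg Fin.val hkl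
    have h3 : (x k + s) % n = (x l + s) % n := by have := h0 k; have := h0 l; lia
    refine hx k l ?_
    simpa using Int.ModEq.dvd (Eq.symm h3)
  refine ⟨Equiv.ofBijective f (Finite.injective_iff_bijective.1 hf), fun k => ?_⟩
  simp [f, Int.toNat_of_nonneg (h0 k)]

/-- Pairwise incongruent `x k` fill all `n` classes, and every shift only permutes them. -/
theorem two_mul_residueSum (hn : 0 < n) {x : Fin n → ℤ}
    (hx : ∀ k l, (n : ℤ) ∣ x k - x l → k = l) (s : ℤ) :
    2 * residueSum n x s = n * (n - 1) := by
  obtain ⟨σ, hσ⟩ := bijective_residue hn hx s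
  simp only [residueSum, hσ]
  rw [Equiv.sum_comp σ (fun k : Fin n => ((k : ℕ) : ℤ)), Fin.sum_univ_eq_sum_range (fun i => (i : ℤ)),
    ← Nat.cast_sum]
  have := Finset.sum_range_id_mul_two n
  zify [Nat.one_le_iff_ne_zero.2 hn.ne'] at this
  rw [mul_comm, Nat.cast_sum, this]

end Residues

/-! ### Riemann–Roch for star lattices -/

section StarLattice

variable {V : Type*} [Fintype V] [DecidableEq V]

/-- The coordinates of the lattice of a star with `n` branches: `b k` is the weighted degree on the
`k`-th branch, `v₀` the center and `leaf k` the end of the `k`-th branch. -/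
structure IsStarLattice (R : V → ℕ) (L : Submodule ℤ (V → ℤ)) {n : ℕ} (v₀ : V) (leaf : Fin n → V)
    (b : Fin n → (V → ℤ) →ₗ[ℤ] ℤ) : Prop where
  pos : 0 < n
  weight_pos : ∀ v, 0 < R v
  wdeg_eq : ∀ D, wdeg R D = n * D v₀ + ∑ k, b k D
  mem_iff : ∀ p, p ∈ L ↔ wdeg R p = 0 ∧ ∀ k l, (n : ℤ) ∣ b k p - b l p
  nonneg : ∀ D, 0 ≤ D → ∀ k, 0 ≤ b k D
  leaf_ne : ∀ k, leaf k ≠ v₀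
  leaf_weight : ∀ k, R (leaf k) = 1
  branch_leaf : ∀ k l, b l (Pi.single (leaf k) 1) = if l = k then 1 else 0
  branch_center : ∀ l, b l (Pi.single v₀ 1) = 0
  branch_single : ∀ v, v ≠ v₀ → ∃ k, ∀ l, b l (Pi.single v 1) = if l = k then (R v : ℤ) else 0

namespace IsStarLattice

variable {R : V → ℕ} {L : Submodule ℤ (V → ℤ)} {n : ℕ} {v₀ : V} {leaf : Fin n → V}
  {b : Fin n → (V → ℤ) →ₗ[ℤ] ℤ}

theorem weight_center (h : IsStarLattice R L v₀ leaf b) : R v₀ = n := by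
  have := h.wdeg_eq (Pi.single v₀ 1)
  rw [wdeg_single] at this
  simpa [h.branch_center] using this

theorem exists_divisor (h : IsStarLattice R L v₀ leaf b) (t : ℤ) (c : Fin n → ℤ) (ht : 0 ≤ t)
    (hc : ∀ k, 0 ≤ c k) :
    ∃ E : V → ℤ, 0 ≤ E ∧ (∀ k, b k E = c k) ∧ wdeg R E = n * t + ∑ k, c k := by
  have hb : ∀ k, b k (t • Pi.single v₀ 1 + ∑ l, c l • Pi.single (leaf l) 1) = c k := by
    intro k
    rw [map_add, map_sum, map_smul, h.branch_center]
    simp only [map_smul, h.branch_leaf]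
    simp
  refine ⟨t • Pi.single v₀ 1 + ∑ l, c l • Pi.single (leaf l) 1, ?_, hb, ?_⟩
  · refine add_nonneg (smul_nonneg ht (Pi.single_nonneg.2 zero_le_one))
      (Finset.sum_nonneg fun k _ => smul_nonneg (hc k) (Pi.single_nonneg.2 zero_le_one))
  · rw [h.wdeg_eq, Finset.sum_congr rfl fun k _ => hb k]
    simp [Finset.sum_apply, (h.leaf_ne _).symm]

/-- For `p ≤ D` in the lattice, `D - p` is effective with branch degrees congruent to `b k D + s`
for one common `s`, hence at least the residues. Conversely, place the residues on the leaves; the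
remaining degree is a nonnegative multiple of `n` and goes to the center. -/
theorem notMem_sigmaRegion_iff (h : IsStarLattice R L v₀ leaf b) (D : V → ℤ) :
    D ∉ sigmaRegion L ↔ ∃ s, residueSum n (fun k => b k D) s ≤ wdeg R D := by
  have hn := h.pos
  constructor
  · intro hD
    simp only [sigmaRegion, Set.mem_ofPred_eq, not_forall, not_not] at hD
    obtain ⟨p, hp, hpD⟩ := hD
    obtain ⟨hdeg, hb⟩ := (h.mem_iff p).1 hp
    have hE : 0 ≤ D - p := sub_nonneg.2 hpD
    refine ⟨-b ⟨0, hn⟩ p, ?_⟩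
    have h1 : residueSum n (fun k => b k D) (-b ⟨0, hn⟩ p) ≤ ∑ k, b k (D - p) := by
      refine Finset.sum_le_sum fun k _ => ?_
      have h2 : (b k D + -b ⟨0, hn⟩ p) % n = b k (D - p) % n := by
        refine Int.emod_eq_emod_iff_emod_sub_eq_zero.2 (Int.emod_eq_zero_of_dvd ?_)
        convert hb k ⟨0, hn⟩ using 1
        rw [map_sub]
        ring
      rw [h2]
      exact Int.emod_natCast_le_self (h.nonneg _ hE k) n
    have h3 := h.wdeg_eq (D - p)
    rw [wdeg_sub, hdeg] at h3
    have h4 : 0 ≤ (n : ℤ) * (D - p) v₀ := mul_nonneg (Int.natCast_nonneg _) (hE v₀)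
    linarith
  · rintro ⟨s, hs⟩ hD
    obtain ⟨t, ht⟩ : (n : ℤ) ∣ wdeg R D - residueSum n (fun k => b k D) s := by
      rw [h.wdeg_eq, add_sub_assoc]
      exact dvd_add (dvd_mul_right _ _) (dvd_sum_sub_residueSum _ _)
    have ht0 : 0 ≤ t := by
      refine nonneg_of_mul_nonneg_right (b := t) (a := (n : ℤ)) ?_ (by lia)
      linarith
    obtain ⟨E, hE, hbE, hdegE⟩ := h.exists_divisor t (fun k => (b k D + s) % n) ht0
      fun k => Int.emod_nonneg _ (by lia)
    refine hD (D - E) ((h.mem_iff _).2 ⟨?_, fun k l => ?_⟩) (sub_le_self _ hE)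
    · rw [wdeg_sub, hdegE, ← ht, residueSum]
      ring
    · rw [map_sub, map_sub, hbE, hbE]
      have h1 : (n : ℤ) ∣ b k D + s - (b k D + s) % n := Int.dvd_self_sub_emod
      have h2 : (n : ℤ) ∣ b l D + s - (b l D + s) % n := Int.dvd_self_sub_emod
      obtain ⟨c, hc⟩ := dvd_sub h1 h2
      exact ⟨c, by linarith⟩

theorem wdeg_le_of_mem_sigmaRegion (h : IsStarLattice R L v₀ leaf b) {D : V → ℤ}
    (hD : D ∈ sigmaRegion L) : wdeg R D ≤ n * n := by
  by_contra! hlt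
  refine (h.notMem_sigmaRegion_iff D).2 ⟨0, le_trans ?_ hlt.le⟩ hD
  refine (Finset.sum_le_sum (g := fun _ => (n : ℤ)) fun k _ => ?_).trans (by simp)
  exact (Int.emod_lt_of_pos _ (by have := h.pos; lia)).le

theorem mem_extremeDivisors_iff (h : IsStarLattice R L v₀ leaf b) (ν : V → ℤ) :
    ν ∈ extremeDivisors R L ↔
      (∀ k l, (n : ℤ) ∣ b k ν - b l ν → k = l) ∧ 2 * wdeg R ν = n * (n - 3) := by
  have hn := h.pos
  rw [_root_.mem_extremeDivisors_iff h.weight_pos]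
  constructor
  · rintro ⟨hν, hmax⟩
    have hlower : ∀ s, wdeg R ν + n ≤ residueSum n (fun k => b k ν) s := by
      intro s
      have h1 : wdeg R ν < residueSum n (fun k => b k ν) s := by
        by_contra! hle
        exact (h.notMem_sigmaRegion_iff ν).2 ⟨s, hle⟩ hν
      have h2 : (n : ℤ) ∣ residueSum n (fun k => b k ν) s - wdeg R ν := by
        rw [dvd_sub_comm, h.wdeg_eq, add_sub_assoc]
        exact dvd_add (dvd_mul_right _ _) (dvd_sum_sub_residueSum _ _)
      have := Int.le_of_dvd (by lia) h2
      lia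
    -- Adding a leaf raises the degree by only one, so leaving the region requires the residue of
    -- branch `k` to wrap around from `n - 1`, and the lower bound to be attained.
    have hleaf : ∀ k, ∃ s, (b k ν + s) % n = n - 1 ∧
        residueSum n (fun k => b k ν) s = wdeg R ν + n := by
      intro k
      obtain ⟨s, hs⟩ := (h.notMem_sigmaRegion_iff _).1 (hmax (leaf k))
      have hl := hlower s
      simp only [map_add, h.branch_leaf] at hs
      rw [residueSum_update, wdeg_add, wdeg_single, h.leaf_weight, add_right_comm,
        Int.add_one_emod_natCast hn] at hs
      refine ⟨s, ?_⟩
      split_ifs at hs with h1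
      · exact ⟨h1, by push_cast at hs; lia⟩
      · push_cast at hs
        lia
    -- Two congruent branches would wrap together at `s + 1`, dropping the residue sum below the
    -- lower bound.
    have hinj : ∀ k l, (n : ℤ) ∣ b k ν - b l ν → k = l := by
      intro k l hkl
      by_contra hne
      obtain ⟨s, hks, hs⟩ := hleaf k
      have hls : (b l ν + s) % n = n - 1 := by
        rw [← hks]
        refine (Int.emod_eq_emod_iff_emod_sub_eq_zero.2 (Int.emod_eq_zero_of_dvd ?_)).symm
        simpa using hkl
      have h1 := hlower (s + 1)
      rw [residueSum_add_one hn] at h1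
      have h2 : ∑ j ∈ {k, l}, (if (b j ν + s) % n = n - 1 then (n : ℤ) else 0) ≤
          ∑ j, if (b j ν + s) % n = n - 1 then (n : ℤ) else 0 :=
        Finset.sum_le_sum_of_subset_of_nonneg (Finset.subset_univ _)
          fun _ _ _ => by split_ifs <;> lia
      rw [Finset.sum_pair hne, if_pos hks, if_pos hls] at h2
      lia
    refine ⟨hinj, ?_⟩
    obtain ⟨s, -, hs⟩ := hleaf ⟨0, hn⟩
    have h3 := two_mul_residueSum hn hinj s
    linarith
  · rintro ⟨hinj, hdeg⟩
    have hsum := two_mul_residueSum hn hinj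
    constructor
    · by_contra hν
      obtain ⟨s, hs⟩ := (h.notMem_sigmaRegion_iff ν).1 hν
      have := hsum s
      have : (0 : ℤ) < n := by lia
      linarith
    · intro v
      rw [h.notMem_sigmaRegion_iff]
      rcases eq_or_ne v v₀ with rfl | hv
      · refine ⟨0, ?_⟩
        simp only [map_add, h.branch_center, add_zero, wdeg_add, wdeg_single, h.weight_center]
        have := hsum 0
        linarith
      · obtain ⟨k, hk⟩ := h.branch_single v hv
        obtain ⟨σ, hσ⟩ := bijective_residue hn hinj 0
        -- This shift gives branch `k` the residue `n - 1`. Adding `v` then lowers the residue sum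
        -- by at least `n - R v` while the degree grows by `R v`, closing the gap of `n`.
        refine ⟨n - 1 - σ k, ?_⟩
        simp only [map_add, hk]
        rw [residueSum_update, wdeg_add, wdeg_single]
        have h1 : (b k ν + (n - 1 - σ k)) % n = (n - 1 : ℤ) := by
          have h2 := hσ k
          rw [add_zero] at h2
          rw [← Int.emod_add_emod, h2, add_sub_cancel, Int.emod_eq_of_lt] <;> lia
        have h3 : (b k ν + R v + (n - 1 - σ k)) % n ≤ (R v : ℤ) - 1 := by
          have h4 := h.weight_pos v
          rw [add_right_comm, ← Int.emod_add_emod, h1,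
            show (n - 1 + R v : ℤ) = R v - 1 + n by ring, Int.add_emod_right]
          exact Int.emod_natCast_le_self (by lia) n
        have := hsum (n - 1 - σ k)
        linarith

theorem extremeDivisors_nonempty (h : IsStarLattice R L v₀ leaf b) :
    (extremeDivisors R L).Nonempty := by
  have hn := h.pos
  -- Put `k` on the `k`-th leaf and `-1` at the center: degree `n(n-1)/2 - n`.
  obtain ⟨E, -, hbE, hdegE⟩ := h.exists_divisor 0 (fun k => (k : ℕ)) le_rfl
    fun k => Int.natCast_nonneg _
  have hb : ∀ k, b k (E - Pi.single v₀ 1) = (k : ℕ) := by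
    intro k
    rw [map_sub, hbE, h.branch_center, sub_zero]
  refine ⟨E - Pi.single v₀ 1, (h.mem_extremeDivisors_iff _).2 ⟨fun k l hkl => ?_, ?_⟩⟩
  · rw [hb, hb] at hkl
    have := Int.eq_zero_of_abs_lt_dvd hkl (by have := k.2; have := l.2; rw [abs_lt]; constructor <;> omega)
    exact Fin.ext (by lia)
  · have := Finset.sum_range_id_mul_two n
    zify [Nat.one_le_iff_ne_zero.2 hn.ne'] at this
    rw [wdeg_sub, hdegE, wdeg_single, h.weight_center,
      Fin.sum_univ_eq_sum_range (fun i => (i : ℤ))]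
    linarith

/-- The lattice lies between the kernel of the degree and `n` times that kernel; the degree is onto
because leaves have weight one. -/
theorem isFullDimensional (h : IsStarLattice R L v₀ leaf b) : IsFullDimensional R L := by
  have hn := h.pos
  refine ⟨fun p hp => ((h.mem_iff p).1 hp).1, ?_⟩
  have hsurj : LinearMap.range (wdegLinear R) = ⊤ := by
    refine LinearMap.range_eq_top.2 fun c => ⟨Pi.single (leaf ⟨0, hn⟩) c, ?_⟩
    change wdeg R _ = c
    rw [wdeg_single, h.leaf_weight]
    simp
  have hker := Submodule.finrank_quotient_add_finrank (LinearMap.ker (wdegLinear R))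
  rw [(wdegLinear R).quotKerEquivRange.finrank_eq, hsurj, finrank_top, Module.finrank_self, Module.finrank_fintype_fun_eq_card] at hker
  have h1 : Module.finrank ℤ L ≤ Module.finrank ℤ (LinearMap.ker (wdegLinear R)) :=
    Submodule.finrank_mono fun p hp => ((h.mem_iff p).1 hp).1
  have hmem : ∀ p : LinearMap.ker (wdegLinear R), (n : ℤ) • (p : V → ℤ) ∈ L := by
    intro p
    refine (h.mem_iff _).2 ⟨?_, fun k l => ?_⟩
    · rw [wdeg_smul, show wdeg R p = 0 from p.2, mul_zero]
    · rw [map_smul, map_smul, ← smul_sub]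
      exact dvd_mul_right _ _
  have h2 : Module.finrank ℤ (LinearMap.ker (wdegLinear R)) ≤ Module.finrank ℤ L := by
    refine LinearMap.finrank_le_finrank_of_injective
      (f := (((n : ℤ) • (LinearMap.ker (wdegLinear R)).subtype).codRestrict L hmem)) ?_
    intro p q hpq
    have h3 : (n : ℤ) • (p : V → ℤ) = (n : ℤ) • (q : V → ℤ) := congrArg Subtype.val hpq
    exact Subtype.ext (smul_right_injective _ (by lia : (n : ℤ) ≠ 0) h3)
  lia

theorem hasRiemannRochProperty (h : IsStarLattice R L v₀ leaf b) :
    HasRiemannRochProperty R L := by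
  obtain ⟨ν, hν⟩ := h.extremeDivisors_nonempty
  refine hasRiemannRochProperty_of_uniform_of_reflection h.isFullDimensional ⟨ν, hν⟩
    (fun D hD => exists_extremeDivisor_ge h.weight_pos
      (fun _ => h.wdeg_le_of_mem_sigmaRegion) hD) (g := wdeg R ν + 1)
    (fun μ hμ => ?_) (K := Pi.single v₀ ((n : ℤ) - 3)) (fun μ hμ => ?_)
  · have h1 := ((h.mem_extremeDivisors_iff _).1 hν).2
    have h2 := ((h.mem_extremeDivisors_iff _).1 hμ).2
    lia
  · obtain ⟨hinj, hdeg⟩ := (h.mem_extremeDivisors_iff _).1 hμ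
    have hK : ∀ k, b k (Pi.single v₀ ((n : ℤ) - 3)) = 0 := by
      intro k
      rw [show (Pi.single v₀ ((n : ℤ) - 3) : V → ℤ) = ((n : ℤ) - 3) • Pi.single v₀ 1 by
        rw [← Pi.single_smul, smul_eq_mul, mul_one], map_smul, h.branch_center, smul_zero]
    refine (h.mem_extremeDivisors_iff _).2 ⟨fun k l hkl => hinj k l ?_, ?_⟩
    · rw [map_sub, map_sub, hK, hK] at hkl
      obtain ⟨c, hc⟩ := hkl
      exact ⟨-c, by linarith⟩
    · rw [wdeg_sub, wdeg_single, h.weight_center]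
      linarith

end IsStarLattice

end StarLattice

/-! ### Harmonic functions on an arithmetical graph -/

namespace ArithmeticalGraph

variable {V : Type*} [Fintype V] {X : ArithmeticalGraph V}

/-- A function on the vertices that is annihilated by the Laplacian. -/
def IsHarmonic (X : ArithmeticalGraph V) {M : Type*} [AddCommGroup M] (z : V → M) : Prop :=
  ∀ v, X.delta v • z v = ∑ w, X.edges w v • z w

theorem isHarmonic_mult_smul {M : Type*} [AddCommGroup M] (y : M) :
    X.IsHarmonic fun v => X.mult v • y := by
  intro v
  simp only [smul_smul, ← Finset.sum_smul, X.edges_symm _ v, X.balanced]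

theorem IsHarmonic.sub {M : Type*} [AddCommGroup M] {x z : V → M} (hx : X.IsHarmonic x)
    (hz : X.IsHarmonic z) : X.IsHarmonic fun v => x v - z v := by
  intro v
  simp only [smul_sub, Finset.sum_sub_distrib, hx v, hz v]

variable [DecidableEq V]

theorem laplacian_col_apply (v w : V) :
    X.laplacian.col v w = (if w = v then (X.delta v : ℤ) else 0) - X.edges w v := by
  simp only [Matrix.col_apply, laplacian, Matrix.sub_apply, Matrix.diagonal_apply,
    Matrix.map_apply]
  split_ifs with h
  · rw [h]
  · rfl

theorem laplacian_col_mem_lattice (v : V) : X.laplacian.col v ∈ X.lattice :=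
  Submodule.subset_span ⟨v, rfl⟩

theorem wdeg_laplacian_col (v : V) : wdeg X.mult (X.laplacian.col v) = 0 := by
  simp only [wdeg, laplacian_col_apply, mul_sub, Finset.sum_sub_distrib, mul_ite, mul_zero,
    Finset.sum_ite_eq', Finset.mem_univ, if_true]
  have := X.balanced v
  zify at this
  rw [mul_comm, this, sub_eq_zero]
  exact Finset.sum_congr rfl fun w _ => by rw [X.edges_symm, mul_comm]

/-- The columns of the Laplacian are the relations of the quotient, so the vertex classes are
harmonic there and the recursion along chains applies to them. -/
theorem isHarmonic_mkQ_single :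
    X.IsHarmonic fun v => X.lattice.mkQ (Pi.single v 1) := by
  intro v
  have h := (Submodule.Quotient.mk_eq_zero X.lattice).2 (X.laplacian_col_mem_lattice v)
  have hcol : X.laplacian.col v =
      X.delta v • Pi.single v (1 : ℤ) - ∑ w, X.edges w v • Pi.single w (1 : ℤ) := by
    ext w
    rw [laplacian_col_apply]
    simp [Pi.single_apply, Finset.sum_apply]
  rw [hcol, ← Submodule.mkQ_apply, map_sub, map_sum, sub_eq_zero, map_nsmul] at h
  simpa only [map_nsmul] using h

end ArithmeticalGraph

/-! ### Euclidean chains and the lattice of a Euclidean star -/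

theorem IsEuclideanSequence.dvd {a b m : ℕ} {r : Fin (m + 2) → ℕ} (h : IsEuclideanSequence a b r)
    {d : ℕ} (ha : d ∣ a) (hb : d ∣ b) (i : Fin (m + 2)) : d ∣ r i := by
  obtain ⟨i, hi⟩ := i
  induction i using Nat.strong_induction_on with
  | _ i ih =>
    match i with
    | 0 => exact h.zero ▸ ha
    | 1 => exact h.one ▸ hb
    | j + 2 =>
      obtain ⟨c, hc⟩ := h.step ⟨j, by lia⟩
      have h1 := ih (j + 1) (by lia) (by lia)
      have h2 := ih j (by lia) (by lia)
      rw [← Int.natCast_dvd_natCast] at h1 h2 ⊢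
      change ((r ⟨j + 2, hi⟩ : ℕ) : ℤ) = c * r ⟨j + 1, by lia⟩ - r ⟨j, by lia⟩ at hc
      rw [hc]
      exact dvd_sub (h1.mul_left _) h2

/-- The chains of a Euclidean star. -/
structure IsEuclideanStarChains {V : Type*} [Fintype V] (X : ArithmeticalGraph V) (v₀ : V)
    {n : ℕ} (b : ℕ) {m : ℕ} (C : Fin n → Fin (m + 2) → V) : Prop where
  chain : ∀ k, IsEuclideanChain X v₀ n b (C k)
  cover : ∀ v, ∃ k i, C k i = v
  share : ∀ k l i j, k ≠ l → C k i = C l j → C k i = v₀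
  separated : ∀ k l i j, k ≠ l → C k i ≠ v₀ → C l j ≠ v₀ → X.edges (C k i) (C l j) = 0

namespace IsEuclideanStarChains

variable {V : Type*} [Fintype V] {X : ArithmeticalGraph V} {v₀ : V} {n b m : ℕ}
  {C : Fin n → Fin (m + 2) → V}

theorem pos (h : IsEuclideanStarChains X v₀ b C) : 0 < n := by
  obtain ⟨k, -⟩ := h.cover v₀
  exact k.pos

theorem mult_center (h : IsEuclideanStarChains X v₀ b C) : X.mult v₀ = n := by
  have hk := h.chain ⟨0, h.pos⟩
  rw [← hk.start]
  exact hk.euclidean.zero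

theorem mult_one (h : IsEuclideanStarChains X v₀ b C) (k : Fin n) : X.mult (C k 1) = b :=
  (h.chain k).euclidean.one

theorem succ_ne (h : IsEuclideanStarChains X v₀ b C) (k : Fin n) (i : Fin (m + 1)) :
    C k i.succ ≠ v₀ := by
  rw [← (h.chain k).start]
  exact fun he => Fin.succ_ne_zero i ((h.chain k).injective he)

theorem eq_of_succ_eq (h : IsEuclideanStarChains X v₀ b C) {k l : Fin n} {i : Fin (m + 1)}
    {j : Fin (m + 2)} (he : C k i.succ = C l j) : k = l := by
  by_contra hne
  exact h.succ_ne k i (h.share k l _ _ hne he)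

theorem exists_of_edges_ne_zero (h : IsEuclideanStarChains X v₀ b C) {k : Fin n}
    {i : Fin (m + 1)} {w : V} (hw : X.edges w (C k i.succ) ≠ 0) :
    ∃ j, w = C k j ∧ ((j : ℕ) = i ∨ (j : ℕ) = i + 2) := by
  obtain ⟨j, rfl⟩ : ∃ j, w = C k j := by
    obtain ⟨l, j, rfl⟩ := h.cover w
    by_cases hlk : l = k
    · exact ⟨j, by rw [hlk]⟩
    · by_cases hj : C l j = v₀
      · exact ⟨0, by rw [hj, (h.chain k).start]⟩
      · exact absurd (h.separated l k j i.succ hlk hj (h.succ_ne k i)) hw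
  refine ⟨j, rfl, ?_⟩
  rw [(h.chain k).induced] at hw
  simp only [Fin.val_succ, ne_eq, ite_eq_right_iff, not_forall] at hw
  obtain ⟨hw, -⟩ := hw
  lia

/-- Harmonicity at a chain vertex expresses the value one step towards the center through the values
at the vertex and beyond it, so zeros propagate inwards from the leaf. -/
theorem eq_zero_of_isHarmonic (h : IsEuclideanStarChains X v₀ b C) {M : Type*} [AddCommGroup M]
    {z : V → M} (hz : X.IsHarmonic z) (k : Fin n) (hleaf : z (C k (Fin.last (m + 1))) = 0)
    (i : Fin (m + 2)) : z (C k i) = 0 := by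
  induction ht : m + 1 - (i : ℕ) using Nat.strong_induction_on generalizing i with
  | _ t ih =>
    rcases Fin.eq_castSucc_or_eq_last i with ⟨j, rfl⟩ | rfl
    · have h1 := hz (C k j.succ)
      rw [Fin.val_castSucc] at ht
      rw [ih _ (by rw [Fin.val_succ]; lia) j.succ rfl, smul_zero,
        Finset.sum_eq_single (C k j.castSucc) ?_ (by simp), (h.chain k).induced,
        if_pos (by simp), one_smul] at h1
      · exact h1.symm
      · intro w _ hw
        by_cases he : X.edges w (C k j.succ) = 0
        · rw [he, zero_smul]
        · obtain ⟨l, rfl, hl | hl⟩ := h.exists_of_edges_ne_zero he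
          · exact absurd (congrArg (C k) (Fin.ext hl)) hw
          · rw [ih _ (by lia) l rfl, smul_zero]
    · exact hleaf

theorem eq_one_of_dvd (h : IsEuclideanStarChains X v₀ b C) {d : ℕ} (hn : d ∣ n) (hb : d ∣ b) :
    d = 1 := by
  rw [← Nat.dvd_one, ← X.mult_gcd]
  refine Finset.dvd_gcd fun v _ => ?_
  obtain ⟨k, i, rfl⟩ := h.cover v
  exact (h.chain k).euclidean.dvd hn hb i

/-- Modulo the leaf multiplicity, the multiplicities are harmonic and vanish at the leaf, hence on
the whole chain; the leaf multiplicity thus divides the coprime numbers `n` and `b`. -/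
theorem mult_last (h : IsEuclideanStarChains X v₀ b C) (k : Fin n) :
    X.mult (C k (Fin.last (m + 1))) = 1 := by
  have h1 : ∀ i, X.mult (C k (Fin.last (m + 1))) ∣ X.mult (C k i) := by
    intro i
    have := h.eq_zero_of_isHarmonic (X.isHarmonic_mult_smul
      (1 : ZMod (X.mult (C k (Fin.last (m + 1)))))) k (by simp) i
    rwa [nsmul_one, ZMod.natCast_eq_zero_iff] at this
  refine h.eq_one_of_dvd ?_ ?_
  · rw [← h.mult_center, ← (h.chain k).start]
    exact h1 0
  · rw [← h.mult_one k]
    exact h1 1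

theorem eq_mult_smul_of_isHarmonic (h : IsEuclideanStarChains X v₀ b C) {M : Type*}
    [AddCommGroup M] {x : V → M} (hx : X.IsHarmonic x) (k : Fin n) (i : Fin (m + 2)) :
    x (C k i) = X.mult (C k i) • x (C k (Fin.last (m + 1))) :=
  sub_eq_zero.1 (h.eq_zero_of_isHarmonic (hx.sub (X.isHarmonic_mult_smul _)) k
    (by rw [h.mult_last, one_smul, sub_self]) i)

theorem sum_eq (h : IsEuclideanStarChains X v₀ b C) {M : Type*} [AddCommMonoid M] (f : V → M) :
    ∑ v, f v = f v₀ + ∑ k, ∑ i : Fin (m + 1), f (C k i.succ) := by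
  let e : Option (Fin n × Fin (m + 1)) → V := fun o => o.elim v₀ fun q => C q.1 q.2.succ
  have he : Function.Bijective e := by
    constructor
    · rintro (_ | ⟨k, i⟩) (_ | ⟨l, j⟩) heq
      · rfl
      · exact absurd heq.symm (h.succ_ne l j)
      · exact absurd heq (h.succ_ne k i)
      · change C k i.succ = C l j.succ at heq
        obtain rfl := h.eq_of_succ_eq heq
        rw [Fin.succ_injective _ ((h.chain k).injective heq)]
    · intro v
      obtain ⟨k, i, rfl⟩ := h.cover v
      rcases Fin.eq_zero_or_eq_succ i with rfl | ⟨j, rfl⟩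
      · exact ⟨none, (h.chain k).start.symm⟩
      · exact ⟨some (k, j), rfl⟩
  rw [← he.sum_comp, Fintype.sum_option, Fintype.sum_prod_type]
  rfl

theorem edges_succ_center (h : IsEuclideanStarChains X v₀ b C) (k : Fin n) (i : Fin (m + 1)) :
    X.edges (C k i.succ) v₀ = if i = 0 then 1 else 0 := by
  rw [← (h.chain k).start, (h.chain k).induced]
  refine if_congr ?_ rfl rfl
  rw [Fin.ext_iff, Fin.val_succ, Fin.val_zero, Fin.val_zero]
  lia

theorem delta_center_smul (h : IsEuclideanStarChains X v₀ b C) {M : Type*} [AddCommGroup M]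
    {x : V → M} (hx : X.IsHarmonic x) : X.delta v₀ • x v₀ = ∑ k, x (C k 1) := by
  rw [hx v₀, h.sum_eq, X.edges_self, zero_smul, zero_add]
  refine Finset.sum_congr rfl fun k _ => ?_
  simp [h.edges_succ_center]

theorem delta_center (h : IsEuclideanStarChains X v₀ b C) : X.delta v₀ = b := by
  have h1 := h.delta_center_smul (X.isHarmonic_mult_smul (1 : ℤ))
  simp only [h.mult_center, h.mult_one, Finset.sum_const, Finset.card_univ, Fintype.card_fin,
    smul_smul] at h1
  rw [nsmul_one, nsmul_one, Nat.cast_inj, mul_comm] at h1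
  exact Nat.eq_of_mul_eq_mul_left h.pos h1

/-- The harmonic value at the center is the sum of the values at the ends of the chains. -/
theorem center_eq_sum_of_isHarmonic (h : IsEuclideanStarChains X v₀ b C) {M : Type*}
    [AddCommGroup M] {x : V → M} (hx : X.IsHarmonic x) :
    x v₀ = ∑ k, x (C k (Fin.last (m + 1))) := by
  rw [← sub_eq_zero, ← AddMonoid.addOrderOf_eq_one_iff]
  -- The difference is killed by `n`, as `n` times each leaf value is the center value, and by `b`,
  -- through harmonicity at the center.
  refine h.eq_one_of_dvd (addOrderOf_dvd_of_nsmul_eq_zero ?_) (addOrderOf_dvd_of_nsmul_eq_zero ?_)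
  · have h1 : ∀ k, n • x (C k (Fin.last (m + 1))) = x v₀ := by
      intro k
      have := h.eq_mult_smul_of_isHarmonic hx k 0
      rwa [(h.chain k).start, h.mult_center, eq_comm] at this
    simp [smul_sub, Finset.smul_sum, h1]
  · have h1 := h.delta_center_smul hx
    simp only [h.delta_center, h.eq_mult_smul_of_isHarmonic hx _ 1, h.mult_one] at h1
    rw [smul_sub, h1, Finset.smul_sum, sub_self]

/-- The weighted degree on a chain without its center. -/
def branch (X : ArithmeticalGraph V) (C : Fin n → Fin (m + 2) → V) (k : Fin n) :
    (V → ℤ) →ₗ[ℤ] ℤ :=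
  ∑ i : Fin (m + 1), (X.mult (C k i.succ) : ℤ) • LinearMap.proj (C k i.succ)

theorem branch_apply (k : Fin n) (D : V → ℤ) :
    branch X C k D = ∑ i : Fin (m + 1), (X.mult (C k i.succ) : ℤ) * D (C k i.succ) := by
  simp [branch]

theorem wdeg_eq (h : IsEuclideanStarChains X v₀ b C) (D : V → ℤ) :
    wdeg X.mult D = n * D v₀ + ∑ k, branch X C k D := by
  simp only [wdeg, branch_apply, h.sum_eq, h.mult_center]

variable [DecidableEq V]

theorem branch_single (h : IsEuclideanStarChains X v₀ b C) (k l : Fin n) (i : Fin (m + 1)) :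
    branch X C l (Pi.single (C k i.succ) 1) =
      if l = k then (X.mult (C k i.succ) : ℤ) else 0 := by
  rw [branch_apply]
  split_ifs with hlk
  · subst hlk
    rw [Finset.sum_eq_single i (fun j _ hj => ?_) (by simp), Pi.single_eq_same, mul_one]
    rw [Pi.single_eq_of_ne, mul_zero]
    exact fun he => hj (Fin.succ_injective _ ((h.chain l).injective he))
  · refine Finset.sum_eq_zero fun j _ => ?_
    rw [Pi.single_eq_of_ne, mul_zero]
    exact fun he => hlk (h.eq_of_succ_eq he)

theorem branch_laplacian_col_center (h : IsEuclideanStarChains X v₀ b C) (k : Fin n) :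
    branch X C k (X.laplacian.col v₀) = -b := by
  rw [branch_apply, Finset.sum_eq_single 0 (fun i _ hi => ?_) (by simp)]
  · rw [X.laplacian_col_apply, if_neg (h.succ_ne k 0), h.edges_succ_center]
    simp [h.mult_one]
  · rw [X.laplacian_col_apply, if_neg (h.succ_ne k i), h.edges_succ_center, if_neg hi]
    simp

/-- Such a column touches only its own branch and the center; having degree zero, its branch degree
cancels a multiple of `n`. -/
theorem dvd_branch_laplacian_col_succ (h : IsEuclideanStarChains X v₀ b C) (k l : Fin n)
    (i : Fin (m + 1)) : (n : ℤ) ∣ branch X C l (X.laplacian.col (C k i.succ)) := by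
  have h0 : ∀ l, l ≠ k → branch X C l (X.laplacian.col (C k i.succ)) = 0 := by
    intro l hl
    rw [branch_apply]
    refine Finset.sum_eq_zero fun j _ => ?_
    rw [X.laplacian_col_apply, if_neg fun he => hl (h.eq_of_succ_eq he),
      h.separated l k _ _ hl (h.succ_ne l j) (h.succ_ne k i)]
    simp
  rcases eq_or_ne l k with rfl | hl
  · have h1 := h.wdeg_eq (X.laplacian.col (C l i.succ))
    rw [X.wdeg_laplacian_col, Finset.sum_eq_single l (fun j _ hj => h0 j hj) (by simp)] at h1
    exact ⟨-X.laplacian.col (C l i.succ) v₀, by linarith⟩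
  · rw [h0 l hl]
    exact dvd_zero _

/-- In the quotient, branch `k` contributes `b k p` times its leaf class, and `n` times any leaf
class is the center class. The congruences therefore allow one common coefficient on all leaves,
whose classes sum to the center class. The total is a multiple of the center class, with coefficient
zero by the degree condition. -/
theorem mem_lattice_of_wdeg_eq_zero (h : IsEuclideanStarChains X v₀ b C) {p : V → ℤ}
    (hdeg : wdeg X.mult p = 0)
    (hp : ∀ k l, (n : ℤ) ∣ branch X C k p - branch X C l p) : p ∈ X.lattice := by
  have hx := X.isHarmonic_mkQ_single
  set x : V → (V → ℤ) ⧸ X.lattice := fun v => X.lattice.mkQ (Pi.single v 1)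
  have hsum : X.lattice.mkQ p = ∑ v, p v • x v := by
    conv_lhs => rw [← Finset.univ_sum_single p, map_sum]
    refine Finset.sum_congr rfl fun v _ => ?_
    rw [← map_smul, ← Pi.single_smul, smul_eq_mul, mul_one]
  have hcenter : ∀ k, x v₀ = (n : ℤ) • x (C k (Fin.last (m + 1))) := by
    intro k
    have := h.eq_mult_smul_of_isHarmonic hx k 0
    rwa [(h.chain k).start, h.mult_center, ← natCast_zsmul] at this
  have hbranch : ∀ k, ∑ i : Fin (m + 1), p (C k i.succ) • x (C k i.succ) =
      branch X C k p • x (C k (Fin.last (m + 1))) := by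
    intro k
    rw [branch_apply, Finset.sum_smul]
    refine Finset.sum_congr rfl fun i _ => ?_
    rw [h.eq_mult_smul_of_isHarmonic hx k i.succ, ← natCast_zsmul, smul_smul, mul_comm]
  let k₀ : Fin n := ⟨0, h.pos⟩
  choose z hz using fun k => hp k k₀
  have hbranch' : ∀ k, branch X C k p • x (C k (Fin.last (m + 1))) =
      branch X C k₀ p • x (C k (Fin.last (m + 1))) + z k • x v₀ := by
    intro k
    rw [hcenter k, smul_smul, ← add_smul, mul_comm (z k), ← hz, add_sub_cancel]
  have hzero : p v₀ + (branch X C k₀ p + ∑ k, z k) = 0 := by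
    have h1 := h.wdeg_eq p
    have h2 : ∑ k, branch X C k p = n * branch X C k₀ p + n * ∑ k, z k := by
      rw [Finset.mul_sum, ← Finset.sum_congr rfl fun k _ => hz k, Finset.sum_sub_distrib]
      simp
    have h3 : (n : ℤ) * (p v₀ + (branch X C k₀ p + ∑ k, z k)) = 0 := by
      rw [← hdeg, h1, h2]
      ring
    exact (mul_eq_zero.1 h3).resolve_left (by have := h.pos; lia)
  rw [← Submodule.Quotient.mk_eq_zero, ← Submodule.mkQ_apply, hsum, h.sum_eq]
  simp only [hbranch, hbranch', Finset.sum_add_distrib, ← Finset.smul_sum, ← Finset.sum_smul]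
  rw [← h.center_eq_sum_of_isHarmonic hx, ← add_smul, ← add_smul, hzero, zero_smul]

theorem mem_lattice_iff (h : IsEuclideanStarChains X v₀ b C) (p : V → ℤ) :
    p ∈ X.lattice ↔ wdeg X.mult p = 0 ∧
      ∀ k l, (n : ℤ) ∣ branch X C k p - branch X C l p := by
  refine ⟨fun hp => ?_, fun hp => h.mem_lattice_of_wdeg_eq_zero hp.1 hp.2⟩
  induction hp using Submodule.span_induction with
  | mem p hp =>
    obtain ⟨v, rfl⟩ := hp
    refine ⟨X.wdeg_laplacian_col v, fun k l => ?_⟩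
    obtain ⟨j, i, rfl⟩ := h.cover v
    rcases Fin.eq_zero_or_eq_succ i with rfl | ⟨i, rfl⟩
    · rw [(h.chain j).start, h.branch_laplacian_col_center, h.branch_laplacian_col_center,
        sub_self]
      exact dvd_zero _
    · exact dvd_sub (h.dvd_branch_laplacian_col_succ j k i)
        (h.dvd_branch_laplacian_col_succ j l i)
  | zero => simp [wdeg]
  | add p q _ _ hp hq =>
    refine ⟨by rw [wdeg_add, hp.1, hq.1, add_zero], fun k l => ?_⟩
    rw [map_add, map_add, add_sub_add_comm]
    exact dvd_add (hp.2 k l) (hq.2 k l)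
  | smul c p _ hp =>
    refine ⟨by rw [wdeg_smul, hp.1, mul_zero], fun k l => ?_⟩
    rw [map_smul, map_smul, ← smul_sub]
    exact (hp.2 k l).mul_left c

theorem isStarLattice (h : IsEuclideanStarChains X v₀ b C) :
    IsStarLattice X.mult X.lattice v₀ (fun k => C k (Fin.last (m + 1))) (branch X C) where
  pos := h.pos
  weight_pos := X.mult_pos
  wdeg_eq := h.wdeg_eq
  mem_iff := h.mem_lattice_iff
  nonneg D hD k := by
    rw [branch_apply]
    exact Finset.sum_nonneg fun i _ => mul_nonneg (Int.natCast_nonneg _) (hD _)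
  leaf_ne k := h.succ_ne k (Fin.last m)
  leaf_weight := h.mult_last
  branch_leaf k l := by
    rw [← Fin.succ_last, h.branch_single, Fin.succ_last, h.mult_last, Nat.cast_one]
  branch_center l := by
    rw [branch_apply]
    exact Finset.sum_eq_zero fun i _ => by rw [Pi.single_eq_of_ne (h.succ_ne l i), mul_zero]
  branch_single v hv := by
    obtain ⟨k, i, rfl⟩ := h.cover v
    rcases Fin.eq_zero_or_eq_succ i with rfl | ⟨i, rfl⟩
    · exact absurd (h.chain k).start hv
    · exact ⟨k, fun l => h.branch_single k l i⟩

end IsEuclideanStarChains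

theorem mainTheorem11 {V : Type*} [Fintype V] [DecidableEq V] (X : ArithmeticalGraph V)
    (v₀ : V) (r₀ r₁ : ℕ) (hX : IsEuclideanStar X v₀ r₀ r₁) :
    X.RiemannRochProperty := by
  obtain ⟨m, C, hchain, hcover, hshare, hseparated⟩ := hX
  have h : IsEuclideanStarChains X v₀ r₁ C := ⟨hchain, hcover, hshare, hseparated⟩
  exact h.isStarLattice.hasRiemannRochProperty
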